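/- Let $d\in\mathbb N$, $s>0$ and $T>0$. Put $H^s(\mathbb R^d)=\{f\in L^2(\mathbb R^d;\mathbb C): \|f\|_{H^s}^2:=\int_{\mathbb R^d}(1+|\xi|^{2s})|\widehat f(\xi)|^2\,d\xi<\infty\}$ and $(-\Delta)^{r}f=\mathcal F^{-1}(|\xi|^{2r}\widehat f)$ for $r>0$ (with the unitary Fourier transform in the angular frequency variable $\xi$). A net $(f_\varepsilon)_{\varepsilon\in(0,1]}$ in a normed space $X$ is called $X$-moderate if there are $N\in\mathbb N_0$ and $C>0$ with $\|f_\varepsilon\|_X\le C\varepsilon^{-N}$ for all $\varepsilon\in(0,1]$, and $X$-negligible if for every $k\in\mathbb N_0$ there is $C>0$ with $\|f_\varepsilon\|_X\le C\varepsilon^{k}$ for all $\varepsilon\in(0,1]$. Let $(a_\varepsilon)$, $(\tilde a_\varepsilon)$, $(b_\varepsilon)$, $(\tilde b_\varepsilon)$ be nets of real-valued, almost everywhere non-negative functions in $L^\infty(\mathbb R^d)$, let $(u_{0,\varepsilon})$, $(\tilde u_{0,\varepsilon})$ be nets in $H^s(\mathbb R^d)$ and $(u_{1,\varepsilon})$,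 $(\tilde u_{1,\varepsilon})$ nets in $L^2(\mathbb R^d)$, all indexed by $\varepsilon\in(0,1]$ (for instance, two families of nets that approximate given singular coefficients $a,b$ and data $u_0,u_1$). Assume that $(a_\varepsilon)$, $(b_\varepsilon)$, $(u_{0,\varepsilon})$, $(u_{1,\varepsilon})$ are $L^\infty$-, $L^\infty$-, $H^s$- and $L^2$-moderate, respectively, and that $(a_\varepsilon-\tilde a_\varepsilon)$, $(b_\varepsilon-\tilde b_\varepsilon)$, $(u_{0,\varepsilon}-\tilde u_{0,\varepsilon})$, $(u_{1,\varepsilon}-\tilde u_{1,\varepsilon})$ are $L^\infty$-, $L^\infty$-, $H^s$- and $L^2$-negligible, respectively. For every $\varepsilon\in(0,1]$ let $u_\varepsilon,\tilde u_\varepsilon\in C([0,T];H^s(\mathbb R^d))\cap C^1([0,T];L^2(\mathbb R^d))$ be solutions of $$\partial_t^2u_\varepsilon+(-\Delta)^su_\varepsilon+a_\varepsilon u_\varepsilon+b_\varepsilon\partial_tu_\varepsilon=0,\qquad u_\varepsilon(0)=u_{0,\varepsilon},\quad \partial_tu_\varepsilon(0)=u_{1,\varepsilon},$$ $$\partial_t^2\tilde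 u_\varepsilon+(-\Delta)^s\tilde u_\varepsilon+\tilde a_\varepsilon\tilde u_\varepsilon+\tilde b_\varepsilon\partial_t\tilde u_\varepsilon=0,\qquad \tilde u_\varepsilon(0)=\tilde u_{0,\varepsilon},\quad \partial_t\tilde u_\varepsilon(0)=\tilde u_{1,\varepsilon}$$ on $[0,T]\times\mathbb R^d$, where the equation is understood in the dual $H^{-s}(\mathbb R^d)$ of $H^s(\mathbb R^d)$ at every $t\in[0,T]$: for every $\varphi\in H^s(\mathbb R^d)$ the function $t\mapsto\langle \partial_tu_\varepsilon(t),\varphi\rangle_{L^2}$ is differentiable on $[0,T]$ (one-sidedly at the end points), and $$\frac{d}{dt}\langle \partial_tu_\varepsilon(t),\varphi\rangle_{L^2}+\langle(-\Delta)^{s/2}u_\varepsilon(t),(-\Delta)^{s/2}\varphi\rangle_{L^2}+\langle a_\varepsilon u_\varepsilon(t)+b_\varepsilon\partial_tu_\varepsilon(t),\varphi\rangle_{L^2}=0$$ (likewise for $\tilde u_\varepsilon$). Then, for every $t\in[0,T]$, the net $(u_\varepsilon(t,\cdot)-\tilde u_\varepsilon(t,\cdot))_{\varepsilon\in(0,1]}$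 is $L^2(\mathbb R^d)$-negligible. -/

import Mathlib

open MeasureTheory Set Filter Topology FourierTransform
open scoped ENNReal

noncomputable section

namespace VeryWeakWave

/-- The Euclidean space `ℝ^d`. -/
abbrev Space (d : ℕ) : Type := EuclideanSpace ℝ (Fin d)

/-- `L²(ℝ^d)`, complex valued, with respect to Lebesgue measure. -/
abbrev L2 (d : ℕ) : Type := Lp ℂ 2 (volume : Measure (Space d))

/-- `L^∞(ℝ^d)`, real valued, with the essential supremum norm and the a.e. order. -/
abbrev LInfty (d : ℕ) : Type := Lp ℝ ∞ (volume : Measure (Space d))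

variable {d : ℕ}

/-- The pointwise product `a f` of `a ∈ L^∞` and `f ∈ L²`, as an element of `L²`. -/
def mulL2 (a : LInfty d) (f : L2 d) : L2 d := a • f

/-- Membership in `H^s(ℝ^d)`: the integral of `(1 + |2πξ|^{2s}) |f̂(ξ)|²` is finite. The Fourier
transform `𝓕` has the kernel `exp (-2πi x·ξ)`, so the frequency variable is `2πξ`. -/
def MemHs (s : ℝ) (f : L2 d) : Prop :=
  Integrable (fun ξ : Space d => (1 + (2 * Real.pi * ‖ξ‖) ^ (2 * s)) * ‖(𝓕 f : L2 d) ξ‖ ^ 2) volume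

/-- The norm of `H^s(ℝ^d)`, for `f` with `MemHs s f`. -/
def hsNorm (s : ℝ) (f : L2 d) : ℝ :=
  Real.sqrt (∫ ξ : Space d, (1 + (2 * Real.pi * ‖ξ‖) ^ (2 * s)) * ‖(𝓕 f : L2 d) ξ‖ ^ 2)

open Classical in
/-- The fractional Laplacian `(-Δ)^r f = 𝓕⁻¹ (|2πξ|^{2r} f̂)` on its `L²` domain
(extended by `0` outside of the domain). -/
def fracLaplacian (r : ℝ) (f : L2 d) : L2 d :=
  if h : MemLp (fun ξ : Space d => (2 * Real.pi * ‖ξ‖) ^ (2 * r) • (𝓕 f : L2 d) ξ) 2 volume then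
    𝓕⁻ (h.toLp _ : L2 d)
  else 0

/-- The time derivative `∂ₜu(t)` on `[0,T]` (one-sided at the end points). -/
def timeDeriv (T : ℝ) (u : ℝ → L2 d) (t : ℝ) : L2 d := derivWithin u (Icc 0 T) t

/-- `u ∈ C([0,T]; H^s(ℝ^d))`. -/
def ContinuousInHs (T s : ℝ) (u : ℝ → L2 d) : Prop :=
  (∀ t ∈ Icc 0 T, MemHs s (u t)) ∧
    ∀ t₀ ∈ Icc 0 T, Tendsto (fun t => hsNorm s (u t - u t₀)) (𝓝[Icc 0 T] t₀) (𝓝 0)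

/-- `u ∈ C([0,T]; H^s) ∩ C¹([0,T]; L²)` solves the Cauchy problem
`∂ₜ²u + (-Δ)^s u + a u + b ∂ₜu = 0` on `[0,T] × ℝ^d`, `u(0) = u₀`, `∂ₜu(0) = u₁`.
The equation holds at every time in the dual space `H^{-s}` of `H^s`, that is, after pairing with
an arbitrary `φ ∈ H^s`; there `⟨φ, (-Δ)^s u⟩` is `⟨(-Δ)^{s/2} φ, (-Δ)^{s/2} u⟩`. -/
structure IsSolution (T s : ℝ) (a b : LInfty d) (u₀ u₁ : L2 d) (u : ℝ → L2 d) : Prop where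
  continuousInHs : ContinuousInHs T s u
  contDiffOn : ContDiffOn ℝ 1 u (Icc 0 T)
  equation : ∀ φ : L2 d, MemHs s φ → ∀ t ∈ Icc 0 T,
    HasDerivWithinAt (fun τ => inner ℂ φ (timeDeriv T u τ))
      (-(inner ℂ (fracLaplacian (s / 2) φ) (fracLaplacian (s / 2) (u t))
        + inner ℂ φ (mulL2 a (u t)) + inner ℂ φ (mulL2 b (timeDeriv T u t))))
      (Icc 0 T) t
  initial_value : u 0 = u₀
  initial_velocity : timeDeriv T u 0 = u₁

/-- A net `(f_ε)`, `ε ∈ (0,1]`, is moderate with respect to the norm `nrm`: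
`nrm (f_ε) ≤ C ε^{-N}` for some `N` and `C`. -/
def IsModerate {X : Type*} (nrm : X → ℝ) (f : ℝ → X) : Prop :=
  ∃ N : ℕ, ∃ C : ℝ, 0 < C ∧ ∀ ε ∈ Ioc (0 : ℝ) 1, nrm (f ε) ≤ C * (ε ^ N)⁻¹

/-- A net `(f_ε)`, `ε ∈ (0,1]`, is negligible with respect to the norm `nrm`:
for every `k` there is `C` with `nrm (f_ε) ≤ C ε^k`. -/
def IsNegligible {X : Type*} (nrm : X → ℝ) (f : ℝ → X) : Prop :=
  ∀ k : ℕ, ∃ C : ℝ, 0 < C ∧ ∀ ε ∈ Ioc (0 : ℝ) 1, nrm (f ε) ≤ C * ε ^ k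

end VeryWeakWave

end

open VeryWeakWave

/-! The difference `w = u - u'` solves the first equation with source `(a - a') u' + (b - b') ∂ₜu'`
and negligible data, so what is needed is a stability estimate whose constants are moderate.
Gronwall's inequality would bring in exponentials of the coefficient norms, which need not be
moderate. Instead the signs are used: with `a, b ≥ 0` the energy `‖∂ₜw‖² + ‖(-Δ)^{s/2} w‖² + ⟨w, a
w⟩` grows only through the source, so the bound (`norm_velocity_le_of_damped`) is polynomial in
`‖a‖` and independent of `‖b‖`. The same bound without source makes `u'` and `∂ₜu'` moderate, and
moderate times negligible is negligible.

The obstacle is that `∂ₜw` lies only in L², hence is not an admissible test function. The energy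
identity is therefore derived for the low frequencies `‖ξ‖ ≤ n`, where (-Δ)^{s/2} is bounded, with
all coefficient terms treated as an L² source; then `n → ∞` (`norm_sq_velocity_le`). -/

open VeryWeakWave

/-! ### Energy estimates in an abstract Hilbert space. -/

section AbstractEnergy

variable {E : Type*} [NormedAddCommGroup E] [InnerProductSpace ℂ E]

theorem hasDerivWithinAt_norm_sq_complex {f : ℝ → E} {f' : E} {S : Set ℝ} {x : ℝ}
    (h : HasDerivWithinAt f f' S x) :
    HasDerivWithinAt (fun t => ‖f t‖ ^ 2) (2 * (inner ℂ (f x) f').re) S x := by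
  have h1 := Complex.reCLM.hasFDerivAt.comp_hasDerivWithinAt x (h.inner ℂ h)
  have h2 : (inner ℂ f' (f x)).re = (inner ℂ (f x) f').re := inner_re_symm (𝕜 := ℂ) _ _
  have h3 : (fun t => ‖f t‖ ^ 2) = Complex.reCLM ∘ fun t => inner ℂ (f t) (f t) := by
    ext t
    exact (inner_self_eq_norm_sq (𝕜 := ℂ) (f t)).symm
  rw [h3]
  exact h1.congr_deriv (by simp [h2, two_mul])

/-- A weakly differentiable function on `[0,T]` with continuous weak derivative is strongly
differentiable. -/
theorem hasDerivWithinAt_of_weak [CompleteSpace E] {T : ℝ} (hT : 0 < T) {y h : ℝ → E}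
    (hh : ContinuousOn h (Icc 0 T))
    (hw : ∀ ψ : E, ∀ t ∈ Icc 0 T,
      HasDerivWithinAt (fun τ => inner ℂ ψ (y τ)) (inner ℂ ψ (h t)) (Icc 0 T) t) :
    ∀ t ∈ Icc 0 T, HasDerivWithinAt y (h t) (Icc 0 T) t := by
  set k : ℝ → E := IccExtend hT.le ((Icc 0 T).domRestrict h)
  have hk : Continuous k := hh.domRestrict.Icc_extend'
  have hkh : ∀ t ∈ Icc 0 T, k t = h t := fun t ht => by
    simp [k, IccExtend_of_mem hT.le _ ht, domRestrict]
  -- The strong antiderivative of `h`; each pairing of `y - F` with a fixed vector has derivative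
  -- zero and vanishes at `0`.
  set F : ℝ → E := fun t => y 0 + ∫ τ in (0 : ℝ)..t, k τ
  have hF : ∀ t, HasDerivAt F (k t) t := fun t =>
    (intervalIntegral.integral_hasDerivAt_right (hk.intervalIntegrable _ _)
      hk.stronglyMeasurable.stronglyMeasurableAtFilter hk.continuousAt).const_add _
  have heq : ∀ t ∈ Icc 0 T, y t = F t := by
    intro t ht
    refine ext_inner_left ℂ fun ψ => ?_
    have hd : ∀ τ ∈ Icc 0 T, HasDerivWithinAt (fun τ => inner ℂ ψ (y τ) - inner ℂ ψ (F τ)) 0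
        (Icc 0 T) τ := by
      intro τ hτ
      have h1 := (hasDerivWithinAt_const τ (Icc 0 T) ψ).inner ℂ (hF τ).hasDerivWithinAt
      exact ((hw ψ τ hτ).fun_sub h1).congr_deriv (by simp [hkh τ hτ])
    have := constant_of_derivWithin_zero (fun τ hτ => (hd τ hτ).differentiableWithinAt)
      (fun τ hτ => (hd τ (Ico_subset_Icc_self hτ)).derivWithin
        (uniqueDiffOn_Icc hT τ (Ico_subset_Icc_self hτ))) t ht
    simpa [F, sub_eq_zero, inner_add_right] using this
  intro t ht
  rw [← hkh t ht]
  exact (hF t).hasDerivWithinAt.congr heq (heq t ht)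

theorem integral_eq_sub_of_hasDerivWithinAt_Icc {T t : ℝ} (ht : t ∈ Icc 0 T) {f f' : ℝ → ℝ}
    (hf : ∀ τ ∈ Icc 0 T, HasDerivWithinAt f (f' τ) (Icc 0 T) τ)
    (hf' : ContinuousOn f' (Icc 0 T)) :
    ∫ τ in (0 : ℝ)..t, f' τ = f t - f 0 := by
  have hsub : Icc 0 t ⊆ Icc 0 T := Icc_subset_Icc_right ht.2
  refine intervalIntegral.integral_eq_sub_of_hasDerivAt_of_le ht.1
    (fun τ hτ => ((hf τ (hsub hτ)).continuousWithinAt).mono hsub) (fun τ hτ => ?_)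
    ((hf'.mono hsub).intervalIntegrable_of_Icc ht.1)
  exact (hf τ (hsub (Ioo_subset_Icc_self hτ))).hasDerivAt
    (Icc_mem_nhds hτ.1 (hτ.2.trans_le ht.2))

/-- Energy inequality for `w'' + Λ² w = g` with the energy of the frequency-truncated
solutions: `P n` are the truncations and `L n = Λ P n`. -/
theorem norm_sq_velocity_le [CompleteSpace E] {T K : ℝ} (hT : 0 < T) {w p g : ℝ → E}
    {P L : ℕ → E →L[ℂ] E}
    (hPsymm : ∀ n x y, inner ℂ (P n x) y = inner ℂ x (P n y))
    (hPP : ∀ n x, P n (P n x) = P n x)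
    (hLP : ∀ n x, L n (P n x) = L n x)
    (hPlim : ∀ x y, Tendsto (fun n => inner ℂ (P n x) y) atTop (𝓝 (inner ℂ x y)))
    (hw : ∀ t ∈ Icc 0 T, HasDerivWithinAt w (p t) (Icc 0 T) t)
    (hp : ContinuousOn p (Icc 0 T)) (hg : ContinuousOn g (Icc 0 T))
    (heq : ∀ n ψ, ∀ t ∈ Icc 0 T, HasDerivWithinAt (fun τ => inner ℂ (P n ψ) (p τ))
      (inner ℂ (P n ψ) (g t) - inner ℂ (L n ψ) (L n (w t))) (Icc 0 T) t)
    (hK : ∀ n, ‖L n (w 0)‖ ≤ K) {t : ℝ} (ht : t ∈ Icc 0 T) :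
    ‖p t‖ ^ 2 ≤ ‖p 0‖ ^ 2 + K ^ 2 + ∫ τ in (0 : ℝ)..t, 2 * (inner ℂ (p τ) (g τ)).re := by
  have hwc : ContinuousOn w (Icc 0 T) := fun τ hτ => (hw τ hτ).continuousWithinAt
  -- `P n` is an orthogonal projection. This identity yields both contractivity and, with the weak
  -- limit, convergence of the norms.
  have hPsq : ∀ n x, ‖P n x‖ ^ 2 = (inner ℂ (P n x) x).re := fun n x => by
    rw [← hPP n x, hPsymm, ← inner_self_eq_norm_sq (𝕜 := ℂ), hPP]; rfl
  have hPle : ∀ n x, ‖P n x‖ ≤ ‖x‖ := fun n x => by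
    have h1 : ‖P n x‖ ^ 2 ≤ ‖P n x‖ * ‖x‖ := (hPsq n x).trans_le (re_inner_le_norm (𝕜 := ℂ) _ _)
    by_contra! h
    nlinarith [norm_nonneg x]
  have key : ∀ n, ‖P n (p t)‖ ^ 2 ≤
      ‖p 0‖ ^ 2 + K ^ 2 + ∫ τ in (0 : ℝ)..t, 2 * (inner ℂ (P n (p τ)) (g τ)).re := by
    intro n
    -- Since `L n` is bounded, the truncated velocity has a continuous weak derivative, hence a
    -- strong one.
    have hPp : ∀ τ ∈ Icc 0 T, HasDerivWithinAt (fun τ => P n (p τ))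
        (P n (g τ) - (L n).adjoint (L n (w τ))) (Icc 0 T) τ := by
      refine hasDerivWithinAt_of_weak hT (by fun_prop) fun ψ τ hτ => ?_
      simpa only [← hPsymm, inner_sub_right, ContinuousLinearMap.adjoint_inner_right]
        using heq n ψ τ hτ
    have hLw : ∀ τ ∈ Icc 0 T, HasDerivWithinAt (fun τ => L n (w τ)) (L n (p τ)) (Icc 0 T) τ :=
      fun τ hτ => ((L n).restrictScalars ℝ).hasFDerivAt.comp_hasDerivWithinAt τ (hw τ hτ)
    -- The cross terms `⟨L n p, L n w⟩` cancel because `L n ∘ P n = L n`; only the source survives.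
    have hE : ∀ τ ∈ Icc 0 T, HasDerivWithinAt (fun τ => ‖P n (p τ)‖ ^ 2 + ‖L n (w τ)‖ ^ 2)
        (2 * (inner ℂ (P n (p τ)) (g τ)).re) (Icc 0 T) τ := by
      intro τ hτ
      refine ((hasDerivWithinAt_norm_sq_complex (hPp τ hτ)).fun_add
        (hasDerivWithinAt_norm_sq_complex (hLw τ hτ))).congr_deriv ?_
      rw [inner_sub_right, ContinuousLinearMap.adjoint_inner_right, hLP, ← hPsymm, hPP,
        Complex.sub_re]
      have : (inner ℂ (L n (p τ)) (L n (w τ))).re = (inner ℂ (L n (w τ)) (L n (p τ))).re :=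
        inner_re_symm (𝕜 := ℂ) _ _
      rw [this]; ring
    have hint := integral_eq_sub_of_hasDerivWithinAt_Icc ht hE
      (by fun_prop)
    rw [hint]
    have h1 : ‖P n (p 0)‖ ^ 2 ≤ ‖p 0‖ ^ 2 := by gcongr; exact hPle _ _
    have h2 : ‖L n (w 0)‖ ^ 2 ≤ K ^ 2 := by gcongr; exact hK n
    nlinarith [sq_nonneg ‖L n (w t)‖]
  have hre : ∀ x y, Tendsto (fun n => (inner ℂ (P n x) y).re) atTop (𝓝 (inner ℂ x y).re) :=
    fun x y => (Complex.continuous_re.tendsto _).comp (hPlim x y)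
  have hlhs : Tendsto (fun n => ‖P n (p t)‖ ^ 2) atTop (𝓝 (‖p t‖ ^ 2)) := by
    have h2 : ‖p t‖ ^ 2 = (inner ℂ (p t) (p t)).re := (inner_self_eq_norm_sq (𝕜 := ℂ) _).symm
    simpa only [hPsq, h2] using hre (p t) (p t)
  refine le_of_tendsto_of_tendsto' hlhs (Tendsto.const_add _ ?_) key
  have hsub : Icc 0 t ⊆ Icc 0 T := Icc_subset_Icc_right ht.2
  have hIoc : uIoc 0 t ⊆ Icc 0 T := by
    rw [uIoc_of_le ht.1]; exact Ioc_subset_Icc_self.trans hsub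
  refine intervalIntegral.tendsto_integral_filter_of_dominated_convergence
    (fun τ => 2 * (‖p τ‖ * ‖g τ‖)) (Eventually.of_forall fun n => ?_)
    (Eventually.of_forall fun n => Eventually.of_forall fun τ _ => ?_) ?_
    (Eventually.of_forall fun τ _ => (hre _ _).const_mul 2)
  · have : ContinuousOn (fun τ => 2 * (inner ℂ (P n (p τ)) (g τ)).re) (Icc 0 T) := by fun_prop
    exact (this.mono hIoc).aestronglyMeasurable measurableSet_uIoc
  · rw [norm_mul, Real.norm_ofNat]
    gcongr
    exact (Complex.abs_re_le_norm _).trans ((norm_inner_le_norm _ _).trans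
      (by gcongr; exact hPle _ _))
  · have : ContinuousOn (fun τ => 2 * (‖p τ‖ * ‖g τ‖)) (Icc 0 T) := by fun_prop
    exact (this.mono hsub).intervalIntegrable_of_Icc ht.1

/-- A priori bound for the velocity of a solution of `w'' + Λ² w + A w + B w' + f = 0` with
non-negative bounded operators `A` and `B`. -/
theorem norm_velocity_le_of_damped [CompleteSpace E] {T K M : ℝ} (hT : 0 < T) {w p f : ℝ → E}
    {P L : ℕ → E →L[ℂ] E} {A B : E →L[ℂ] E}
    (hPsymm : ∀ n x y, inner ℂ (P n x) y = inner ℂ x (P n y))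
    (hPP : ∀ n x, P n (P n x) = P n x)
    (hLP : ∀ n x, L n (P n x) = L n x)
    (hPlim : ∀ x y, Tendsto (fun n => inner ℂ (P n x) y) atTop (𝓝 (inner ℂ x y)))
    (hAsymm : ∀ x y, inner ℂ (A x) y = inner ℂ x (A y))
    (hA : ∀ x, 0 ≤ (inner ℂ x (A x)).re) (hB : ∀ x, 0 ≤ (inner ℂ x (B x)).re)
    (hw : ∀ t ∈ Icc 0 T, HasDerivWithinAt w (p t) (Icc 0 T) t)
    (hp : ContinuousOn p (Icc 0 T)) (hf : ContinuousOn f (Icc 0 T))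
    (heq : ∀ n ψ, ∀ t ∈ Icc 0 T, HasDerivWithinAt (fun τ => inner ℂ (P n ψ) (p τ))
      (-(inner ℂ (L n ψ) (L n (w t)) + inner ℂ (P n ψ) (A (w t)) + inner ℂ (P n ψ) (B (p t))
        + inner ℂ (P n ψ) (f t))) (Icc 0 T) t)
    (hK : ∀ n, ‖L n (w 0)‖ ≤ K) (hM : ∀ t ∈ Icc 0 T, ‖f t‖ ≤ M) {t : ℝ} (ht : t ∈ Icc 0 T) :
    ‖p t‖ ≤ ‖p 0‖ + K + (1 + ‖A‖) * ‖w 0‖ + 2 * T * M := by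
  have hwc : ContinuousOn w (Icc 0 T) := fun τ hτ => (hw τ hτ).continuousWithinAt
  have h0 : (0 : ℝ) ∈ Icc 0 T := left_mem_Icc.2 hT.le
  have hK0 : 0 ≤ K := (norm_nonneg _).trans (hK 0)
  have hM0 : 0 ≤ M := (norm_nonneg _).trans (hM 0 h0)
  -- Evaluating the energy at a maximum point of the speed gives a quadratic inequality for `‖p r‖`,
  -- which replaces Gronwall.
  obtain ⟨r, hr, hmax⟩ := isCompact_Icc.exists_isMaxOn ⟨0, h0⟩ hp.norm
  have hmax' : ∀ τ ∈ Icc 0 T, ‖p τ‖ ≤ ‖p r‖ := fun τ hτ => hmax hτ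
  refine (hmax' t ht).trans ?_
  have hen := norm_sq_velocity_le (K := K) (g := fun τ => -(A (w τ) + B (p τ) + f τ)) hT hPsymm hPP
    hLP hPlim hw hp (by fun_prop) (fun n ψ τ hτ => by
      convert heq n ψ τ hτ using 1
      simp only [inner_neg_right, inner_add_right]; ring) hK hr
  -- By symmetry of `A` its contribution is an exact derivative, so it is integrated rather than
  -- estimated.
  have hAd : ∀ τ ∈ Icc 0 T, HasDerivWithinAt (fun τ => (inner ℂ (w τ) (A (w τ))).re)
      (2 * (inner ℂ (p τ) (A (w τ))).re) (Icc 0 T) τ := by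
    intro τ hτ
    have h1 := ((A.restrictScalars ℝ).hasFDerivAt).comp_hasDerivWithinAt τ (hw τ hτ)
    have h2 := Complex.reCLM.hasFDerivAt.comp_hasDerivWithinAt τ ((hw τ hτ).inner ℂ h1)
    refine h2.congr_deriv ?_
    have h3 : (inner ℂ (w τ) (A (p τ))).re = (inner ℂ (p τ) (A (w τ))).re := by
      rw [← hAsymm]; exact inner_re_symm (𝕜 := ℂ) _ _
    simp [h3, two_mul]
  have hAint := integral_eq_sub_of_hasDerivWithinAt_Icc hr hAd (by fun_prop)
  have hsub : Icc 0 r ⊆ Icc 0 T := Icc_subset_Icc_right hr.2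
  have hcA : ContinuousOn (fun τ => 2 * (inner ℂ (p τ) (A (w τ))).re) (Icc 0 T) := by fun_prop
  have hcg : ContinuousOn (fun τ => 2 * (inner ℂ (p τ) (-(A (w τ) + B (p τ) + f τ))).re)
    (Icc 0 T) := by fun_prop
  have hbound : (∫ τ in (0 : ℝ)..r, 2 * (inner ℂ (p τ) (-(A (w τ) + B (p τ) + f τ))).re)
      + ∫ τ in (0 : ℝ)..r, 2 * (inner ℂ (p τ) (A (w τ))).re ≤ 2 * (‖p r‖ * M) * r := by
    rw [← intervalIntegral.integral_add ((hcg.mono hsub).intervalIntegrable_of_Icc hr.1)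
      ((hcA.mono hsub).intervalIntegrable_of_Icc hr.1)]
    have := intervalIntegral.integral_mono_on (μ := volume) hr.1
      (((hcg.add hcA).mono hsub).intervalIntegrable_of_Icc hr.1)
      (intervalIntegrable_const (c := 2 * (‖p r‖ * M))) fun τ hτ => by
        have h1 := hB (p τ)
        have h2 : -(‖p r‖ * M) ≤ (inner ℂ (p τ) (f τ)).re := by
          refine neg_le_of_abs_le ((Complex.abs_re_le_norm _).trans
            ((norm_inner_le_norm _ _).trans ?_))
          gcongr
          · exact hmax' τ (hsub hτ)
          · exact hM τ (hsub hτ)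
        simp only [Pi.add_apply, inner_neg_right, inner_add_right, Complex.neg_re, Complex.add_re]
        linarith
    refine this.trans_eq ?_
    simp only [intervalIntegral.integral_const, sub_zero, smul_eq_mul]; ring
  have hA0 : (inner ℂ (w 0) (A (w 0))).re ≤ ‖A‖ * ‖w 0‖ ^ 2 := by
    refine (re_inner_le_norm (𝕜 := ℂ) _ _).trans ?_
    have := A.le_opNorm (w 0)
    nlinarith [norm_nonneg (w 0)]
  have hAr := hA (w r)
  have hpr := norm_nonneg (p r)
  have hTr : 2 * (‖p r‖ * M) * r ≤ 2 * (‖p r‖ * M) * T := by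
    gcongr; exact hr.2
  have hquad : ‖p r‖ ^ 2 ≤ (‖p 0‖ + K + (1 + ‖A‖) * ‖w 0‖) ^ 2 + 2 * T * M * ‖p r‖ := by
    -- The factor `1 + ‖A‖` is a crude substitute for `√‖A‖`.
    have hexp : ‖p 0‖ ^ 2 + K ^ 2 + ‖A‖ * ‖w 0‖ ^ 2 ≤
        (‖p 0‖ + K + (1 + ‖A‖) * ‖w 0‖) ^ 2 := by
      have e : (‖p 0‖ + K + (1 + ‖A‖) * ‖w 0‖) ^ 2 = ‖p 0‖ ^ 2 + K ^ 2 + ‖A‖ * ‖w 0‖ ^ 2 +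
        (2 * ‖p 0‖ * K + 2 * (‖p 0‖ + K) * ((1 + ‖A‖) * ‖w 0‖)
          + (1 + ‖A‖ + ‖A‖ ^ 2) * ‖w 0‖ ^ 2) := by ring
      rw [e]
      have : 0 ≤ 2 * ‖p 0‖ * K + 2 * (‖p 0‖ + K) * ((1 + ‖A‖) * ‖w 0‖)
          + (1 + ‖A‖ + ‖A‖ ^ 2) * ‖w 0‖ ^ 2 := by positivity
      linarith
    linarith
  set Q := ‖p 0‖ + K + (1 + ‖A‖) * ‖w 0‖
  have hQ : 0 ≤ Q := by positivity
  have hTM : 0 ≤ 2 * T * M := by positivity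
  -- If `‖p r‖ > Q + 2TM`, multiplying by `‖p r‖ ≥ Q` contradicts the quadratic inequality.
  by_contra! hlt
  nlinarith

theorem norm_le_add_mul_of_hasDerivWithinAt {T S : ℝ} {w p : ℝ → E}
    (hw : ∀ t ∈ Icc 0 T, HasDerivWithinAt w (p t) (Icc 0 T) t)
    (hS : ∀ t ∈ Icc 0 T, ‖p t‖ ≤ S) {t : ℝ} (ht : t ∈ Icc 0 T) :
    ‖w t‖ ≤ ‖w 0‖ + T * S := by
  have h0 : (0 : ℝ) ∈ Icc 0 T := left_mem_Icc.2 (ht.1.trans ht.2)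
  have h1 := (convex_Icc 0 T).norm_image_sub_le_of_norm_hasDerivWithin_le hw hS h0 ht
  have h2 : S * ‖t - 0‖ ≤ T * S := by
    rw [sub_zero, Real.norm_of_nonneg ht.1, mul_comm]
    have := (norm_nonneg _).trans (hS 0 h0)
    gcongr
    exact ht.2
  have h3 := norm_le_norm_add_norm_sub' (w t) (w 0)
  linarith

end AbstractEnergy

/-! ### Multiplication operators, Fourier multipliers and the `H^s` norm. -/

section Multipliers

variable {d : ℕ}

theorem norm_sq_eq_integral (f : L2 d) : ‖f‖ ^ 2 = ∫ x, ‖f x‖ ^ 2 := by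
  rw [← inner_self_eq_norm_sq (𝕜 := ℂ) f, L2.inner_def, ← integral_re (L2.integrable_inner f f)]
  exact integral_congr_ae (Eventually.of_forall fun x => inner_self_eq_norm_sq (𝕜 := ℂ) (f x))

theorem integrable_norm_sq (f : L2 d) : Integrable (fun x => ‖f x‖ ^ 2) :=
  (memLp_two_iff_integrable_sq_norm (Lp.aestronglyMeasurable f)).1 (Lp.memLp f)

/-- Multiplication by an `L^∞` function, as a bounded operator on `L²`. -/
noncomputable def mulCLM (a : LInfty d) : L2 d →L[ℂ] L2 d :=
  LinearMap.mkContinuous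
    { toFun := mulL2 a
      map_add' := Lp.add_smul a
      map_smul' := fun c f => by
        refine Lp.ext ?_
        filter_upwards [Lp.coeFn_lpSMul (r := 2) a (c • f), Lp.coeFn_smul c (mulL2 a f),
          Lp.coeFn_lpSMul (r := 2) a f, Lp.coeFn_smul c f] with x h1 h2 h3 h4
        rw [RingHom.id_apply, h2, mulL2, h1, Pi.smul_apply', h4, Pi.smul_apply, Pi.smul_apply,
          mulL2, h3, Pi.smul_apply', smul_comm] } ‖a‖ (Lp.norm_smul_le a)

theorem norm_mulCLM_le (a : LInfty d) : ‖mulCLM a‖ ≤ ‖a‖ :=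
  LinearMap.mkContinuous_norm_le _ (norm_nonneg a) _

theorem coeFn_mulCLM (a : LInfty d) (f : L2 d) :
    mulCLM a f =ᵐ[volume] fun x => a x • f x :=
  Lp.coeFn_lpSMul a f

theorem mulCLM_sub (a b : LInfty d) (f : L2 d) :
    mulCLM (a - b) f = mulCLM a f - mulCLM b f := by
  refine eq_sub_of_add_eq ?_
  have := Lp.smul_add (r := 2) (a - b) b f
  rw [sub_add_cancel] at this
  exact this.symm

theorem inner_mulCLM_left (a : LInfty d) (f g : L2 d) :
    inner ℂ (mulCLM a f) g = inner ℂ f (mulCLM a g) := by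
  rw [L2.inner_def, L2.inner_def]
  refine integral_congr_ae ?_
  filter_upwards [coeFn_mulCLM a f, coeFn_mulCLM a g] with x hf hg
  rw [hf, hg, inner_smul_left_eq_smul, inner_smul_right_eq_smul]

theorem re_inner_mulCLM_nonneg {a : LInfty d} (ha : 0 ≤ a) (f : L2 d) :
    0 ≤ (inner ℂ f (mulCLM a f)).re := by
  have hint : Integrable (fun x => inner ℂ (f x) ((mulCLM a f) x)) := L2.integrable_inner _ _
  have hre : (inner ℂ f (mulCLM a f)).re = ∫ x, (inner ℂ (f x) ((mulCLM a f) x)).re := by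
    rw [L2.inner_def]
    exact (integral_re hint).symm
  rw [hre]
  refine integral_nonneg_of_ae ?_
  filter_upwards [coeFn_mulCLM a f, (Lp.coeFn_nonneg a).2 ha] with x hf hx
  have h1 : 0 ≤ (inner ℂ (f x) (f x)).re :=
    inner_self_nonneg (𝕜 := ℂ) (x := f x)
  simp only [Pi.zero_apply] at hx ⊢
  rw [hf, inner_smul_right_eq_smul, Complex.smul_re]
  positivity

/-- The Fourier multiplier with an `L^∞` symbol. -/
noncomputable def multiplier (m : LInfty d) : L2 d →L[ℂ] L2 d :=
  (Lp.fourierTransformₗᵢ (Space d) ℂ).symm.toContinuousLinearEquiv.toContinuousLinearMap ∘L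
    mulCLM m ∘L (Lp.fourierTransformₗᵢ (Space d) ℂ).toContinuousLinearEquiv.toContinuousLinearMap

theorem fourier_multiplier (m : LInfty d) (f : L2 d) :
    𝓕 (multiplier m f) = mulCLM m (𝓕 f : L2 d) :=
  (Lp.fourierTransformₗᵢ (Space d) ℂ).apply_symm_apply _

theorem coeFn_fourier_multiplier (m : LInfty d) (f : L2 d) :
    (𝓕 (multiplier m f) : L2 d) =ᵐ[volume] fun ξ => m ξ • (𝓕 f : L2 d) ξ := by
  rw [fourier_multiplier]
  exact coeFn_mulCLM _ _

theorem fourier_injective {f g : L2 d} (h : (𝓕 f : L2 d) = 𝓕 g) : f = g :=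
  (Lp.fourierTransformₗᵢ (Space d) ℂ).injective h

theorem inner_multiplier_left (m : LInfty d) (f g : L2 d) :
    inner ℂ (multiplier m f) g = inner ℂ f (multiplier m g) := by
  rw [← Lp.inner_fourier_eq, fourier_multiplier, inner_mulCLM_left, ← fourier_multiplier,
    Lp.inner_fourier_eq]

/-- The symbol `|2πξ|^s` of `(-Δ)^{s/2}`. -/
noncomputable def symbol (s : ℝ) (ξ : Space d) : ℝ := (2 * Real.pi * ‖ξ‖) ^ s

theorem symbol_nonneg (s : ℝ) (ξ : Space d) : 0 ≤ symbol s ξ := by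
  unfold symbol; positivity

theorem measurable_symbol (s : ℝ) : Measurable (symbol s : Space d → ℝ) := by
  unfold symbol; fun_prop

theorem symbol_sq (s : ℝ) (ξ : Space d) : (2 * Real.pi * ‖ξ‖) ^ (2 * s) = symbol s ξ ^ 2 := by
  rw [symbol, mul_comm 2 s, Real.rpow_mul (by positivity)]; norm_cast

theorem memLp_indicator_one (n : ℕ) :
    MemLp ((Metric.closedBall (0 : Space d) n).indicator fun _ => (1 : ℝ)) ∞ volume :=
  memLp_top_of_bound
    (measurable_const.indicator Metric.isClosed_closedBall.measurableSet).aestronglyMeasurable 1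
    (Eventually.of_forall fun ξ => by
      by_cases h : ξ ∈ Metric.closedBall (0 : Space d) n <;> simp [h])

theorem memLp_indicator_symbol {s : ℝ} (hs : 0 < s) (n : ℕ) :
    MemLp ((Metric.closedBall (0 : Space d) n).indicator (symbol s)) ∞ volume :=
  memLp_top_of_bound
    ((measurable_symbol s).indicator Metric.isClosed_closedBall.measurableSet).aestronglyMeasurable
    ((2 * Real.pi * n) ^ s) (Eventually.of_forall fun ξ => by
      by_cases h : ξ ∈ Metric.closedBall (0 : Space d) n
      · rw [indicator_of_mem h, Real.norm_of_nonneg (symbol_nonneg s ξ), symbol]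
        rw [mem_closedBall_zero_iff] at h
        gcongr
      · rw [indicator_of_notMem h, norm_zero]; positivity)

/-- The projection onto the frequencies `‖ξ‖ ≤ n`. -/
noncomputable def lowPass (n : ℕ) : L2 d →L[ℂ] L2 d := multiplier ((memLp_indicator_one n).toLp _)

/-- The operator `(-Δ)^{s/2}` restricted to the frequencies `‖ξ‖ ≤ n`. -/
noncomputable def truncFracLaplacian {s : ℝ} (hs : 0 < s) (n : ℕ) : L2 d →L[ℂ] L2 d :=
  multiplier ((memLp_indicator_symbol hs n).toLp _)

theorem coeFn_fourier_lowPass (n : ℕ) (f : L2 d) :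
    (𝓕 (lowPass n f) : L2 d) =ᵐ[volume]
      fun ξ => (Metric.closedBall (0 : Space d) n).indicator (fun _ => (1 : ℝ)) ξ • (𝓕 f : L2 d) ξ := by
  filter_upwards [coeFn_fourier_multiplier ((memLp_indicator_one n).toLp _) f,
    (memLp_indicator_one (d := d) n).coeFn_toLp] with ξ h1 h2
  rw [lowPass, h1, h2]

theorem coeFn_fourier_truncFracLaplacian {s : ℝ} (hs : 0 < s) (n : ℕ) (f : L2 d) :
    (𝓕 (truncFracLaplacian hs n f) : L2 d) =ᵐ[volume]
      fun ξ => (Metric.closedBall (0 : Space d) n).indicator (symbol s) ξ • (𝓕 f : L2 d) ξ := by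
  filter_upwards [coeFn_fourier_multiplier ((memLp_indicator_symbol hs n).toLp _) f,
    (memLp_indicator_symbol (d := d) hs n).coeFn_toLp] with ξ h1 h2
  rw [truncFracLaplacian, h1, h2]

theorem lowPass_lowPass (n : ℕ) (f : L2 d) : lowPass n (lowPass n f) = lowPass n f := by
  refine fourier_injective (Lp.ext ?_)
  filter_upwards [coeFn_fourier_lowPass n f, coeFn_fourier_lowPass n (lowPass n f)] with ξ h1 h2
  rw [h2, h1]
  by_cases h : ξ ∈ Metric.closedBall (0 : Space d) n <;> simp [h]

theorem truncFracLaplacian_lowPass {s : ℝ} (hs : 0 < s) (n : ℕ) (f : L2 d) :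
    truncFracLaplacian hs n (lowPass n f) = truncFracLaplacian hs n f := by
  refine fourier_injective (Lp.ext ?_)
  filter_upwards [coeFn_fourier_lowPass n f, coeFn_fourier_truncFracLaplacian hs n f,
    coeFn_fourier_truncFracLaplacian hs n (lowPass n f)] with ξ h1 h2 h3
  rw [h3, h1, h2]
  by_cases h : ξ ∈ Metric.closedBall (0 : Space d) n <;> simp [h]

/-- By Plancherel and dominated convergence: at each frequency the cutoff is eventually `1`. -/
theorem tendsto_inner_lowPass (f g : L2 d) :
    Tendsto (fun n => inner ℂ (lowPass n f) g) atTop (𝓝 (inner ℂ f g)) := by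
  simp only [← Lp.inner_fourier_eq _ g]
  simp only [L2.inner_def]
  refine tendsto_integral_of_dominated_convergence
    (fun ξ => ‖inner ℂ ((𝓕 f : L2 d) ξ) ((𝓕 g : L2 d) ξ)‖)
    (fun n => (L2.integrable_inner _ _).aestronglyMeasurable)
    (L2.integrable_inner _ _).norm (fun n => ?_) ?_
  · filter_upwards [coeFn_fourier_lowPass n f] with ξ h
    rw [h]
    by_cases h : ξ ∈ Metric.closedBall (0 : Space d) n
    · simp [h]
    · rw [indicator_of_notMem h, zero_smul, inner_zero_left, norm_zero]
      positivity
  · filter_upwards [ae_all_iff.2 fun n => coeFn_fourier_lowPass n f] with ξ h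
    refine tendsto_const_nhds.congr' ?_
    filter_upwards [eventually_ge_atTop ⌈‖ξ‖⌉₊] with n hn
    have hmem : ξ ∈ Metric.closedBall (0 : Space d) n :=
      mem_closedBall_zero_iff.2 (Nat.ceil_le.1 hn)
    rw [h n, indicator_of_mem hmem, one_smul]

/-- The weight splits as `1 + symbol²` and the first part is always integrable. Thus `H^s` is
exactly the set where `fracLaplacian (s / 2)` takes its genuine branch. -/
theorem memHs_iff_memLp {s : ℝ} {f : L2 d} :
    MemHs s f ↔ MemLp (fun ξ => symbol s ξ • (𝓕 f : L2 d) ξ) 2 volume := by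
  have hm : AEStronglyMeasurable (fun ξ => symbol s ξ • (𝓕 f : L2 d) ξ) volume :=
    (measurable_symbol s).aestronglyMeasurable.smul (Lp.aestronglyMeasurable _)
  rw [memLp_two_iff_integrable_sq_norm hm, MemHs]
  have h : (fun ξ : Space d => (1 + (2 * Real.pi * ‖ξ‖) ^ (2 * s)) * ‖(𝓕 f : L2 d) ξ‖ ^ 2) =
      (fun ξ => ‖(𝓕 f : L2 d) ξ‖ ^ 2) + fun ξ => ‖symbol s ξ • (𝓕 f : L2 d) ξ‖ ^ 2 := by
    ext ξ
    rw [Pi.add_apply, symbol_sq, norm_smul, mul_pow, Real.norm_eq_abs, sq_abs]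
    ring
  rw [h]
  exact integrable_add_iff_integrable_right (integrable_norm_sq (𝓕 f : L2 d))

theorem memHs_sub {s : ℝ} {f g : L2 d} (hf : MemHs s f) (hg : MemHs s g) : MemHs s (f - g) := by
  rw [memHs_iff_memLp] at *
  refine (memLp_congr_ae ?_).1 (hf.sub hg)
  have : (𝓕 (f - g) : L2 d) = 𝓕 f - 𝓕 g := (Lp.fourierTransformₗᵢ (Space d) ℂ).map_sub f g
  rw [this]
  filter_upwards [Lp.coeFn_sub (𝓕 f : L2 d) (𝓕 g : L2 d)] with ξ h
  rw [h, Pi.sub_apply, Pi.sub_apply, smul_sub]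

theorem memHs_lowPass {s : ℝ} (hs : 0 < s) (n : ℕ) (f : L2 d) : MemHs s (lowPass n f) := by
  rw [memHs_iff_memLp]
  refine (memLp_congr_ae ?_).1 (Lp.memLp (𝓕 (truncFracLaplacian hs n f) : L2 d))
  filter_upwards [coeFn_fourier_lowPass n f, coeFn_fourier_truncFracLaplacian hs n f] with ξ h1 h2
  rw [h1, h2]
  by_cases h : ξ ∈ Metric.closedBall (0 : Space d) n <;> simp [h]

theorem coeFn_fourier_fracLaplacian {s : ℝ} {f : L2 d} (hf : MemHs s f) :
    (𝓕 (fracLaplacian (s / 2) f) : L2 d) =ᵐ[volume] fun ξ => symbol s ξ • (𝓕 f : L2 d) ξ := by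
  have h := memHs_iff_memLp.1 hf
  have e : (fun ξ : Space d => (2 * Real.pi * ‖ξ‖) ^ (2 * (s / 2)) • (𝓕 f : L2 d) ξ) =
      fun ξ => symbol s ξ • (𝓕 f : L2 d) ξ := by
    ext ξ; rw [mul_div_cancel₀ s two_ne_zero]; rfl
  rw [← e] at h ⊢
  rw [fracLaplacian, dif_pos h, FourierTransform.fourier_fourierInv_eq]
  exact h.coeFn_toLp

/-- A band-limited test function sees only the low frequencies of `f`, so the unbounded form reduces
to bounded operators. -/
theorem inner_fracLaplacian_lowPass {s : ℝ} (hs : 0 < s) (n : ℕ) (ψ : L2 d) {f : L2 d}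
    (hf : MemHs s f) :
    inner ℂ (fracLaplacian (s / 2) (lowPass n ψ)) (fracLaplacian (s / 2) f) =
      inner ℂ (truncFracLaplacian hs n ψ) (truncFracLaplacian hs n f) := by
  rw [← Lp.inner_fourier_eq, ← Lp.inner_fourier_eq (truncFracLaplacian hs n ψ),
    L2.inner_def, L2.inner_def]
  refine integral_congr_ae ?_
  filter_upwards [coeFn_fourier_fracLaplacian (memHs_lowPass hs n ψ), coeFn_fourier_fracLaplacian hf,
    coeFn_fourier_lowPass n ψ, coeFn_fourier_truncFracLaplacian hs n ψ,
    coeFn_fourier_truncFracLaplacian hs n f] with ξ h1 h2 h3 h4 h5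
  rw [h1, h2, h3, h4, h5]
  by_cases h : ξ ∈ Metric.closedBall (0 : Space d) n <;> simp [h]

theorem hsNorm_sq {s : ℝ} (f : L2 d) :
    hsNorm s f ^ 2 = ∫ ξ : Space d, (1 + (2 * Real.pi * ‖ξ‖) ^ (2 * s)) * ‖(𝓕 f : L2 d) ξ‖ ^ 2 :=
  Real.sq_sqrt (integral_nonneg fun ξ => by positivity)

theorem hsNorm_nonneg {s : ℝ} (f : L2 d) : 0 ≤ hsNorm s f := Real.sqrt_nonneg _

theorem norm_le_hsNorm {s : ℝ} {f : L2 d} (hf : MemHs s f) : ‖f‖ ≤ hsNorm s f := by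
  refine (sq_le_sq₀ (norm_nonneg _) (hsNorm_nonneg f)).1 ?_
  rw [hsNorm_sq, ← Lp.norm_fourier_eq, norm_sq_eq_integral]
  refine integral_mono (integrable_norm_sq _) hf fun ξ => ?_
  have : 0 ≤ (2 * Real.pi * ‖ξ‖) ^ (2 * s) := by positivity
  exact le_mul_of_one_le_left (by positivity) (by linarith)

/-- The bound is uniform in `n`, as the passage `n → ∞` requires. -/
theorem norm_truncFracLaplacian_le_hsNorm {s : ℝ} (hs : 0 < s) (n : ℕ) {f : L2 d}
    (hf : MemHs s f) : ‖truncFracLaplacian hs n f‖ ≤ hsNorm s f := by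
  refine (sq_le_sq₀ (norm_nonneg _) (hsNorm_nonneg f)).1 ?_
  rw [hsNorm_sq, ← Lp.norm_fourier_eq, norm_sq_eq_integral]
  refine integral_mono_ae (integrable_norm_sq _) hf ?_
  filter_upwards [coeFn_fourier_truncFracLaplacian hs n f] with ξ h1
  rw [h1, norm_smul, mul_pow, symbol_sq]
  by_cases h : ξ ∈ Metric.closedBall (0 : Space d) n
  · rw [indicator_of_mem h, Real.norm_eq_abs, sq_abs]
    gcongr
    linarith
  · rw [indicator_of_notMem h]
    rw [norm_zero, zero_pow two_ne_zero, zero_mul]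
    positivity

end Multipliers

/-! ### A priori and stability estimates for solutions. -/

section Solutions

variable {d : ℕ} {T s : ℝ} {a b a' b' : LInfty d} {u₀ u₁ u₀' u₁' : L2 d} {u v : ℝ → L2 d}

theorem VeryWeakWave.IsSolution.hasDerivWithinAt (h : IsSolution T s a b u₀ u₁ u) {t : ℝ}
    (ht : t ∈ Icc 0 T) : HasDerivWithinAt u (timeDeriv T u t) (Icc 0 T) t :=
  (h.contDiffOn.differentiableOn one_ne_zero t ht).hasDerivWithinAt

theorem VeryWeakWave.IsSolution.continuousOn_timeDeriv (h : IsSolution T s a b u₀ u₁ u)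
    (hT : 0 < T) : ContinuousOn (timeDeriv T u) (Icc 0 T) :=
  h.contDiffOn.continuousOn_derivWithin (uniqueDiffOn_Icc hT) le_rfl

theorem VeryWeakWave.IsSolution.truncated_equation (h : IsSolution T s a b u₀ u₁ u) (hs : 0 < s)
    (n : ℕ) (ψ : L2 d) {t : ℝ} (ht : t ∈ Icc 0 T) :
    HasDerivWithinAt (fun τ => inner ℂ (lowPass n ψ) (timeDeriv T u τ))
      (-(inner ℂ (truncFracLaplacian hs n ψ) (truncFracLaplacian hs n (u t))
        + inner ℂ (lowPass n ψ) (mulCLM a (u t))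
        + inner ℂ (lowPass n ψ) (mulCLM b (timeDeriv T u t)))) (Icc 0 T) t := by
  rw [← inner_fracLaplacian_lowPass hs n ψ (h.continuousInHs.1 t ht)]
  exact h.equation _ (memHs_lowPass hs n ψ) t ht

/-- The case of zero source. Taking `K` as a bound for linear images of `u₀`, instead of `hsNorm s
u₀`, spares a triangle inequality for `hsNorm` when `u₀` is a perturbed datum. -/
theorem VeryWeakWave.IsSolution.norm_timeDeriv_le (h : IsSolution T s a b u₀ u₁ u) (hs : 0 < s)
    (hT : 0 < T) (ha : 0 ≤ a) (hb : 0 ≤ b) {K : ℝ} (hK₀ : ‖u₀‖ ≤ K)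
    (hK : ∀ n, ‖truncFracLaplacian hs n u₀‖ ≤ K) {t : ℝ} (ht : t ∈ Icc 0 T) :
    ‖timeDeriv T u t‖ ≤ ‖u₁‖ + (2 + ‖a‖) * K := by
  have := norm_velocity_le_of_damped (K := K) (M := 0) (f := fun _ => 0) (P := lowPass)
    (A := mulCLM a) (B := mulCLM b) hT
    (fun n => inner_multiplier_left _) lowPass_lowPass (truncFracLaplacian_lowPass hs)
    tendsto_inner_lowPass (inner_mulCLM_left a) (re_inner_mulCLM_nonneg ha)
    (re_inner_mulCLM_nonneg hb) (fun t ht => h.hasDerivWithinAt ht)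
    (h.continuousOn_timeDeriv hT) continuousOn_const
    (fun n ψ t ht => by simpa only [inner_zero_right, add_zero] using h.truncated_equation hs n ψ ht)
    (by rwa [h.initial_value]) (fun _ _ => norm_zero.le) ht
  rw [h.initial_value, h.initial_velocity] at this
  have h2 : (1 + ‖mulCLM a‖) * ‖u₀‖ ≤ (1 + ‖a‖) * K := by
    have := norm_mulCLM_le a
    gcongr
  linarith

/-- Stability of the Cauchy problem under perturbations of the coefficients and of the data. -/
theorem VeryWeakWave.IsSolution.norm_sub_le (h : IsSolution T s a b u₀ u₁ u)
    (h' : IsSolution T s a' b' u₀' u₁' v) (hs : 0 < s) (hT : 0 < T) (ha : 0 ≤ a) (hb : 0 ≤ b)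
    (h₀ : MemHs s (u₀ - u₀')) {V W : ℝ} (hV : ∀ t ∈ Icc 0 T, ‖timeDeriv T v t‖ ≤ V)
    (hW : ∀ t ∈ Icc 0 T, ‖v t‖ ≤ W) {t : ℝ} (ht : t ∈ Icc 0 T) :
    ‖u t - v t‖ ≤ hsNorm s (u₀ - u₀') + T * (‖u₁ - u₁'‖ + (2 + ‖a‖) * hsNorm s (u₀ - u₀')
      + 2 * T * (‖a - a'‖ * W + ‖b - b'‖ * V)) := by
  have hderiv : ∀ t ∈ Icc 0 T, HasDerivWithinAt (fun t => u t - v t)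
      (timeDeriv T u t - timeDeriv T v t) (Icc 0 T) t := fun t ht =>
    (h.hasDerivWithinAt ht).fun_sub (h'.hasDerivWithinAt ht)
  have hc := h.continuousOn_timeDeriv hT
  have hc' := h'.continuousOn_timeDeriv hT
  have hvc : ContinuousOn v (Icc 0 T) := h'.contDiffOn.continuousOn
  have hspeed : ∀ t ∈ Icc 0 T, ‖timeDeriv T u t - timeDeriv T v t‖ ≤ ‖u₁ - u₁'‖
      + (2 + ‖a‖) * hsNorm s (u₀ - u₀') + 2 * T * (‖a - a'‖ * W + ‖b - b'‖ * V) := by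
    intro t ht
    -- The source comes from `a u - a' v = a (u - v) + (a - a') v`, and likewise for `b`.
    have key := norm_velocity_le_of_damped (K := hsNorm s (u₀ - u₀'))
      (M := ‖a - a'‖ * W + ‖b - b'‖ * V)
      (f := fun τ => mulCLM (a - a') (v τ) + mulCLM (b - b') (timeDeriv T v τ)) (P := lowPass)
      (A := mulCLM a) (B := mulCLM b) hT
      (fun n => inner_multiplier_left _) lowPass_lowPass (truncFracLaplacian_lowPass hs)
      tendsto_inner_lowPass (inner_mulCLM_left a) (re_inner_mulCLM_nonneg ha)
      (re_inner_mulCLM_nonneg hb) hderiv (hc.sub hc') (by fun_prop)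
      (fun n ψ t ht => by
        simp only [inner_sub_right]
        refine ((h.truncated_equation hs n ψ ht).fun_sub
          (h'.truncated_equation hs n ψ ht)).congr_deriv ?_
        simp only [mulCLM_sub, map_sub, inner_sub_right, inner_add_right]
        ring)
      (fun n => by
        rw [h.initial_value, h'.initial_value]
        exact norm_truncFracLaplacian_le_hsNorm hs n h₀)
      (fun τ hτ => by
        refine (norm_add_le _ _).trans (add_le_add ?_ ?_)
        · exact ((mulCLM (a - a')).le_opNorm _).trans (mul_le_mul (norm_mulCLM_le _) (hW τ hτ)
            (norm_nonneg _) (norm_nonneg _))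
        · exact ((mulCLM (b - b')).le_opNorm _).trans (mul_le_mul (norm_mulCLM_le _) (hV τ hτ)
            (norm_nonneg _) (norm_nonneg _))) ht
    rw [h.initial_value, h'.initial_value, h.initial_velocity, h'.initial_velocity] at key
    have h2 : (1 + ‖mulCLM a‖) * ‖u₀ - u₀'‖ ≤ (1 + ‖a‖) * hsNorm s (u₀ - u₀') := by
      have := norm_mulCLM_le a
      have := norm_le_hsNorm h₀
      gcongr
    linarith
  refine (norm_le_add_mul_of_hasDerivWithinAt hderiv hspeed ht).trans ?_
  rw [h.initial_value, h'.initial_value]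
  gcongr
  exact norm_le_hsNorm h₀

end Solutions

/-! ### Arithmetic of moderate and negligible real nets. -/

section Nets

variable {f g : ℝ → ℝ}

theorem isModerate_const {c : ℝ} (hc : 0 < c) : IsModerate id fun _ => c :=
  ⟨0, c, hc, fun ε _ => by simp⟩

theorem VeryWeakWave.IsModerate.add (hf : IsModerate id f) (hg : IsModerate id g) :
    IsModerate id fun ε => f ε + g ε := by
  obtain ⟨N, C, hC, h⟩ := hf
  obtain ⟨M, D, hD, h'⟩ := hg
  refine ⟨N + M, C + D, by positivity, fun ε hε => ?_⟩
  have hε0 : 0 < ε := hε.1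
  have h1 : ε ^ (N + M) ≤ ε ^ N := pow_le_pow_of_le_one hε0.le hε.2 (by omega)
  have h2 : ε ^ (N + M) ≤ ε ^ M := pow_le_pow_of_le_one hε0.le hε.2 (by omega)
  rw [add_mul]
  refine (add_le_add (h ε hε) (h' ε hε)).trans ?_
  gcongr

/-- With `id` as the norm the bounds are one-sided, so multiplying them needs a sign. -/
theorem VeryWeakWave.IsModerate.mul (hf : IsModerate id f) (hg : IsModerate id g)
    (hg0 : ∀ ε ∈ Ioc (0 : ℝ) 1, 0 ≤ g ε) : IsModerate id fun ε => f ε * g ε := by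
  obtain ⟨N, C, hC, h⟩ := hf
  obtain ⟨M, D, hD, h'⟩ := hg
  refine ⟨N + M, C * D, by positivity, fun ε hε => ?_⟩
  have hε0 : 0 < ε := hε.1
  refine (mul_le_mul (h ε hε) (h' ε hε) (hg0 ε hε) (by positivity)).trans_eq ?_
  rw [pow_add, mul_inv]
  ring

theorem VeryWeakWave.IsNegligible.isModerate (hf : IsNegligible id f) : IsModerate id f := by
  obtain ⟨C, hC, h⟩ := hf 0
  exact ⟨0, C, hC, fun ε hε => by simpa using h ε hε⟩

theorem VeryWeakWave.IsNegligible.add (hf : IsNegligible id f) (hg : IsNegligible id g) :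
    IsNegligible id fun ε => f ε + g ε := by
  intro k
  obtain ⟨C, hC, h⟩ := hf k
  obtain ⟨D, hD, h'⟩ := hg k
  exact ⟨C + D, by positivity, fun ε hε => (add_le_add (h ε hε) (h' ε hε)).trans_eq (by ring)⟩

theorem VeryWeakWave.IsModerate.mul_isNegligible (hf : IsModerate id f) (hg : IsNegligible id g)
    (hg0 : ∀ ε ∈ Ioc (0 : ℝ) 1, 0 ≤ g ε) : IsNegligible id fun ε => f ε * g ε := by
  intro k
  obtain ⟨N, C, hC, h⟩ := hf
  -- The `N` extra powers absorb the growth `ε^{-N}` of `f`.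
  obtain ⟨D, hD, h'⟩ := hg (N + k)
  refine ⟨C * D, by positivity, fun ε hε => ?_⟩
  have hε0 : 0 < ε := hε.1
  refine (mul_le_mul (h ε hε) (h' ε hε) (hg0 ε hε) (by positivity)).trans_eq ?_
  rw [pow_add]
  field_simp

end Nets

/-! ### Negligibility of the difference of the solutions. -/

theorem theorem3p3 (d : ℕ) (s T : ℝ) (hs : 0 < s) (hT : 0 < T)
    -- two families of coefficients and data, indexed by `ε ∈ (0,1]`
    (a a' b b' : ℝ → LInfty d) (u₀ u₀' u₁ u₁' : ℝ → L2 d)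
    (ha : ∀ ε ∈ Ioc (0 : ℝ) 1, 0 ≤ a ε) (ha' : ∀ ε ∈ Ioc (0 : ℝ) 1, 0 ≤ a' ε)
    (hb : ∀ ε ∈ Ioc (0 : ℝ) 1, 0 ≤ b ε) (hb' : ∀ ε ∈ Ioc (0 : ℝ) 1, 0 ≤ b' ε)
    (hu₀ : ∀ ε ∈ Ioc (0 : ℝ) 1, MemHs s (u₀ ε))
    (hu₀' : ∀ ε ∈ Ioc (0 : ℝ) 1, MemHs s (u₀' ε))
    -- moderateness
    (ham : IsModerate norm a) (hbm : IsModerate norm b)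
    (hu₀m : IsModerate (hsNorm s) u₀) (hu₁m : IsModerate norm u₁)
    -- negligibility of the differences
    (han : IsNegligible norm (fun ε => a ε - a' ε))
    (hbn : IsNegligible norm (fun ε => b ε - b' ε))
    (hu₀n : IsNegligible (hsNorm s) (fun ε => u₀ ε - u₀' ε))
    (hu₁n : IsNegligible norm (fun ε => u₁ ε - u₁' ε))
    -- the corresponding families of solutions
    (u u' : ℝ → ℝ → L2 d)
    (hu : ∀ ε ∈ Ioc (0 : ℝ) 1, IsSolution T s (a ε) (b ε) (u₀ ε) (u₁ ε) (u ε))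
    (hu' : ∀ ε ∈ Ioc (0 : ℝ) 1, IsSolution T s (a' ε) (b' ε) (u₀' ε) (u₁' ε) (u' ε)) :
    ∀ t ∈ Icc (0 : ℝ) T, IsNegligible norm (fun ε => u ε t - u' ε t) := by
  intro t ht
  replace ham : IsModerate id fun ε => ‖a ε‖ := ham
  replace hu₀m : IsModerate id fun ε => hsNorm s (u₀ ε) := hu₀m
  replace hu₁m : IsModerate id fun ε => ‖u₁ ε‖ := hu₁m
  replace han : IsNegligible id fun ε => ‖a ε - a' ε‖ := han
  replace hbn : IsNegligible id fun ε => ‖b ε - b' ε‖ := hbn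
  replace hu₀n : IsNegligible id fun ε => hsNorm s (u₀ ε - u₀' ε) := hu₀n
  replace hu₁n : IsNegligible id fun ε => ‖u₁ ε - u₁' ε‖ := hu₁n
  -- `K`, `V`, `W` majorize the data, velocity and size of `u'`. The primed nets are not assumed
  -- moderate, so they are controlled through the unprimed ones and the differences.
  set K : ℝ → ℝ := fun ε => hsNorm s (u₀ ε) + hsNorm s (u₀ ε - u₀' ε)
  set V : ℝ → ℝ := fun ε => ‖u₁ ε‖ + ‖u₁ ε - u₁' ε‖ + (2 + (‖a ε‖ + ‖a ε - a' ε‖)) * K ε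
  set W : ℝ → ℝ := fun ε => K ε + T * V ε
  have hK0 : ∀ ε, 0 ≤ K ε := fun ε => add_nonneg (hsNorm_nonneg _) (hsNorm_nonneg _)
  have hV0 : ∀ ε, 0 ≤ V ε := fun ε => by have := hK0 ε; positivity
  have hKm : IsModerate id K := hu₀m.add hu₀n.isModerate
  have hVm : IsModerate id V := (hu₁m.add hu₁n.isModerate).add
    (((isModerate_const two_pos).add (ham.add han.isModerate)).mul hKm fun ε _ => hK0 ε)
  have hWm : IsModerate id W := hKm.add ((isModerate_const hT).mul hVm fun ε _ => hV0 ε)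
  have hdata : IsNegligible id fun ε => ‖u₁ ε - u₁' ε‖ + (2 + ‖a ε‖) * hsNorm s (u₀ ε - u₀' ε)
      + (2 * T) * (W ε * ‖a ε - a' ε‖ + V ε * ‖b ε - b' ε‖) :=
    (hu₁n.add (((isModerate_const two_pos).add ham).mul_isNegligible hu₀n
      fun ε _ => hsNorm_nonneg _)).add
      ((isModerate_const (by positivity)).mul_isNegligible
        ((hWm.mul_isNegligible han fun ε _ => norm_nonneg _).add
          (hVm.mul_isNegligible hbn fun ε _ => norm_nonneg _))
        fun ε _ => by have := hK0 ε; have := hV0 ε; positivity)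
  have hbound := hu₀n.add ((isModerate_const hT).mul_isNegligible hdata fun ε _ => by
    have := hK0 ε
    have := hV0 ε
    have := hsNorm_nonneg (s := s) (u₀ ε - u₀' ε)
    positivity)
  intro k
  obtain ⟨C, hC, h⟩ := hbound k
  refine ⟨C, hC, fun ε hε => le_trans ?_ (h ε hε)⟩
  have h₀ := memHs_sub (hu₀ ε hε) (hu₀' ε hε)
  have hK₀ : ‖u₀' ε‖ ≤ K ε :=
    (norm_le_norm_add_norm_sub (u₀ ε) (u₀' ε)).trans
      (add_le_add (norm_le_hsNorm (hu₀ ε hε)) (norm_le_hsNorm h₀))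
  have hKL : ∀ n, ‖truncFracLaplacian hs n (u₀' ε)‖ ≤ K ε := fun n => by
    refine (norm_le_norm_add_norm_sub (truncFracLaplacian hs n (u₀ ε)) _).trans ?_
    rw [← map_sub]
    exact add_le_add (norm_truncFracLaplacian_le_hsNorm hs n (hu₀ ε hε))
      (norm_truncFracLaplacian_le_hsNorm hs n h₀)
  have hV : ∀ t ∈ Icc 0 T, ‖timeDeriv T (u' ε) t‖ ≤ V ε := fun t ht => by
    refine ((hu' ε hε).norm_timeDeriv_le hs hT (ha' ε hε) (hb' ε hε) hK₀ hKL ht).trans ?_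
    have := hK0 ε
    have := norm_le_norm_add_norm_sub (a ε) (a' ε)
    have := norm_le_norm_add_norm_sub (u₁ ε) (u₁' ε)
    simp only [V]
    gcongr
  have hW : ∀ t ∈ Icc 0 T, ‖u' ε t‖ ≤ W ε := fun t ht => by
    refine (norm_le_add_mul_of_hasDerivWithinAt (fun t ht => (hu' ε hε).hasDerivWithinAt ht)
      hV ht).trans ?_
    rw [(hu' ε hε).initial_value]
    simp only [W]
    gcongr
  refine ((hu ε hε).norm_sub_le (hu' ε hε) hs hT (ha ε hε) (hb ε hε) h₀ hV hW ht).trans_eq ?_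
  simp only [id]
  ring
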